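/- Consider a non-degenerate Gaussian graphical model $p(x)\propto\exp\{-\tfrac12x^TJx+h^Tx\}$ on a finite graph $\mathcal G=(\mathcal V,\mathcal E)$, where $J$ is symmetric positive definite, normalized so that $J_{ii}=1$ for all $i$, and, for $i\ne j$, $(i,j)\in\mathcal E$ if and only if $J_{ij}\neq0$. Let $R=I-J$ and assume that the model is walk-summable: for all $i,j\in\mathcal V$ the sum $\sum_{w}\phi(w)$ over all walks $w=(w_0,\dots,w_l)$ in $\mathcal G$ from $i$ to $j$, where $\phi(w)=\prod_{s=1}^{l}R_{w_{s-1},w_s}$, converges for any order of the summands (equivalently $\rho(\bar R)<1$, where $\bar R_{ij}=|R_{ij}|$). A feedback vertex set (FVS) is a set of nodes whose removal leaves a cycle-free graph; a pseudo-FVS is a subset of an FVS that does not break all the cycles. Loopy belief propagation (LBP) with information matrix $A$ and potential vector $b$ on a graph $G$ iterates, on all directed edges $i\to j$ of $G$, $$\Delta J^{(t)}_{i\to j}=-A_{ji}\big(\hat J^{(t-1)}_{i\setminus j}\big)^{-1}A_{ij},\qquad \Delta h^{(t)}_{i\to j}=-A_{ji}\big(\hat J^{(t-1)}_{i\setminus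 j}\big)^{-1}\hat h^{(t-1)}_{i\setminus j},$$ $$\hat J_{i\setminus j}=A_{ii}+\sum_{k\in N(i)\setminus j}\Delta J_{k\to i},\qquad \hat h_{i\setminus j}=b_i+\sum_{k\in N(i)\setminus j}\Delta h_{k\to i}.$$ It converges if $\hat J^{(t)}_{i\setminus j}\ne0$ for all $t$ and all edges, all messages converge, and at the limit all $\hat J_{i\setminus j}$ and all $\hat J_i=A_{ii}+\sum_{k\in N(i)}\Delta J_{k\to i}$ are nonzero; it then returns the variances $\hat J_i^{-1}$ and the means $\hat J_i^{-1}\hat h_i$, where $\hat h_i=b_i+\sum_{k\in N(i)}\Delta h_{k\to i}$, computed from the limit messages. Approximate feedback message passing (FMP) with $\tilde{\mathcal F}\subset\mathcal V$ and $\tilde{\mathcal T}=\mathcal V\setminus\tilde{\mathcal F}$ proceeds as follows. 1. For each $p\in\tilde{\mathcal F}$ let $h^p=J_{\tilde{\mathcal T},p}$. 2. Run LBP on the subgraph induced by $\tilde{\mathcal T}$ with information matrix $J_{\tilde{\mathcal T}}$ and potential $h_{\tilde{\mathcal T}}$, giving partial means $\mu^{\tilde{\mathcal T}}_i$ and partial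 variances $P^{\tilde{\mathcal T}}_{ii}$; and, for each $p\in\tilde{\mathcal F}$, run LBP with potential $h^p$, giving means $g^p_i$. 3. For $p,q\in\tilde{\mathcal F}$ form $(\hat J_{\tilde{\mathcal F}})_{pq}=J_{pq}-\sum_{j\in N(p)\cap\tilde{\mathcal T}}J_{pj}g^q_j$ and $(\hat h_{\tilde{\mathcal F}})_p=h_p-\sum_{j\in N(p)\cap\tilde{\mathcal T}}J_{pj}\mu^{\tilde{\mathcal T}}_j$; return $P_{\tilde{\mathcal F}}=\hat J_{\tilde{\mathcal F}}^{-1}$ and $\mu_{\tilde{\mathcal F}}=P_{\tilde{\mathcal F}}\hat h_{\tilde{\mathcal F}}$. 4. For $i\in\tilde{\mathcal T}$ put $\tilde h_i=h_i-\sum_{j\in N(i)\cap\tilde{\mathcal F}}J_{ij}(\mu_{\tilde{\mathcal F}})_j$. 5. Run LBP on $\tilde{\mathcal T}$ with $J_{\tilde{\mathcal T}}$ and potential $\tilde h$, and return its means on $\tilde{\mathcal T}$ and the variances $P_{ii}=P^{\tilde{\mathcal T}}_{ii}+\sum_{p,q\in\tilde{\mathcal F}}g^p_i(P_{\tilde{\mathcal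 F}})_{pq}g^q_i$, $i\in\tilde{\mathcal T}$. It converges if all its LBP runs converge and $\hat J_{\tilde{\mathcal F}}$ is invertible. Then, for every pseudo-FVS $\tilde{\mathcal F}\subset\mathcal V$, and for every initialization of the LBP runs with $\Delta J^{(0)}_{i\to j}\ge0$ and arbitrary $\Delta h^{(0)}_{i\to j}$ (in particular for all messages initialized at $0$), approximate FMP converges. -/

import Mathlib

noncomputable section

/-- A (non-degenerate) Gaussian graphical model on the node set `V`: the density is proportional
to `exp (-xᵀ J x / 2 + hᵀ x)` with `J` symmetric positive definite, and the graph is the sparsity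
pattern of `J`. -/
structure GaussianGraphicalModel (V : Type*) [Fintype V] where
  graph : SimpleGraph V
  J : Matrix V V ℝ
  h : V → ℝ
  posDef : J.PosDef
  adj_iff : ∀ i j, i ≠ j → (graph.Adj i j ↔ J i j ≠ 0)

/-! ### Walk-sums -/

/-- Weight of a walk: the product of the edge weights `R` along its steps
(`1` for a walk of length zero). -/
def walkWeight {V : Type*} {G : SimpleGraph V} (R : Matrix V V ℝ) :
    {i j : V} → G.Walk i j → ℝ
  | _, _, .nil => 1
  | _, _, .cons (u := u) (v := v) _ p => R u v * walkWeight R p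

namespace GaussianGraphicalModel

/-- The edge-weight matrix `R = I - J`. -/
def edgeWeight {V : Type*} [Fintype V] [DecidableEq V] (M : GaussianGraphicalModel V) :
    Matrix V V ℝ :=
  1 - M.J

/-- Walk-summability: for all `i`, `j` the sum of the weights of all walks from `i` to `j`
converges, whatever the order of the summands. (`Summable` is unconditional summability.) -/
def WalkSummable {V : Type*} [Fintype V] [DecidableEq V] (M : GaussianGraphicalModel V) : Prop :=
  ∀ i j : V, Summable fun w : M.graph.Walk i j => walkWeight M.edgeWeight w

end GaussianGraphicalModel

/-! ### Feedback vertex sets -/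

/-- The graph obtained by removing the nodes in `F` and their incident edges. -/
def remainingGraph {V : Type*} (G : SimpleGraph V) (F : Finset V) : SimpleGraph {i // i ∉ F} :=
  G.comap Subtype.val

/-- A feedback vertex set: its removal leaves a cycle-free graph. -/
def IsFVS {V : Type*} (G : SimpleGraph V) (F : Finset V) : Prop :=
  (remainingGraph G F).IsAcyclic

/-- A pseudo-FVS: a subset of an FVS that does not break all the cycles. -/
def IsPseudoFVS {V : Type*} (G : SimpleGraph V) (F : Finset V) : Prop :=
  (∃ F' : Finset V, IsFVS G F' ∧ F ⊆ F') ∧ ¬ IsFVS G F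

/-! ### Loopy belief propagation -/

/-- A family of Gaussian messages `ΔJ_{i→j}`, `Δh_{i→j}`. Only the values at adjacent pairs
`(i, j)` matter. -/
structure Messages (V : Type*) where
  dJ : V → V → ℝ
  dh : V → V → ℝ

namespace LBP

variable {V : Type*} [Fintype V]

open Classical in
/-- `x_{i∖j} = x_i + ∑_{k ∈ N(i)∖j} m_{k→i}`; this gives `Ĵ_{i∖j}` for `x_i = J_ii`, `m = ΔJ`,
and `ĥ_{i∖j}` for `x_i = h_i`, `m = Δh`. -/
def cavity (G : SimpleGraph V) (x : V → ℝ) (m : V → V → ℝ) (i j : V) : ℝ :=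
  x i + ∑ k with G.Adj i k ∧ k ≠ j, m k i

open Classical in
/-- `x_i + ∑_{k ∈ N(i)} m_{k→i}`; this gives `Ĵ_i` and `ĥ_i`. -/
def node (G : SimpleGraph V) (x : V → ℝ) (m : V → V → ℝ) (i : V) : ℝ :=
  x i + ∑ k with G.Adj i k, m k i

/-- One parallel update of all messages. -/
def update (G : SimpleGraph V) (J : Matrix V V ℝ) (h : V → ℝ) (m : Messages V) : Messages V where
  dJ i j := -(J j i) * (cavity G J.diag m.dJ i j)⁻¹ * J i j
  dh i j := -(J j i) * (cavity G J.diag m.dJ i j)⁻¹ * cavity G h m.dh i j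

/-- The messages after `t` iterations, started at `m₀`. -/
def iterate (G : SimpleGraph V) (J : Matrix V V ℝ) (h : V → ℝ) (m₀ : Messages V) :
    ℕ → Messages V
  | 0 => m₀
  | t + 1 => update G J h (iterate G J h m₀ t)

/-- LBP with information matrix `J` and potential vector `h`, initialized at `m₀`, converges to
the fixed-point messages `m`: no update divides by zero, every message converges, and at the
limit the message updates and the means and variances are well defined. -/
structure ConvergesTo (G : SimpleGraph V) (J : Matrix V V ℝ) (h : V → ℝ) (m₀ m : Messages V) :
    Prop where
  iterate_ne_zero : ∀ t i j, G.Adj i j → cavity G J.diag (iterate G J h m₀ t).dJ i j ≠ 0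
  tendsto_dJ : ∀ i j, G.Adj i j →
    Filter.Tendsto (fun t => (iterate G J h m₀ t).dJ i j) Filter.atTop (nhds (m.dJ i j))
  tendsto_dh : ∀ i j, G.Adj i j →
    Filter.Tendsto (fun t => (iterate G J h m₀ t).dh i j) Filter.atTop (nhds (m.dh i j))
  limit_ne_zero : ∀ i j, G.Adj i j → cavity G J.diag m.dJ i j ≠ 0
  node_ne_zero : ∀ i, node G J.diag m.dJ i ≠ 0

/-- The variance `Ĵ_i⁻¹` computed from the fixed-point messages. -/
def variance (G : SimpleGraph V) (J : Matrix V V ℝ) (m : Messages V) (i : V) : ℝ :=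
  (node G J.diag m.dJ i)⁻¹

/-- The mean `Ĵ_i⁻¹ ĥ_i` computed from the fixed-point messages. -/
def mean (G : SimpleGraph V) (J : Matrix V V ℝ) (h : V → ℝ) (m : Messages V) (i : V) : ℝ :=
  (node G J.diag m.dJ i)⁻¹ * node G h m.dh i

end LBP

/-! ### Approximate feedback message passing -/

/-- Messages for all the LBP runs of approximate FMP with feedback nodes `F`: the first-round run
with potential `h_T`, the first-round runs with the extra potentials `h^p`, `p ∈ F`, and the
second-round run. Used both for the initializations and for the fixed-point messages. -/
structure FMPMessages {V : Type*} (F : Finset V) where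
  base : Messages {i // i ∉ F}
  gain : {p // p ∈ F} → Messages {i // i ∉ F}
  second : Messages {i // i ∉ F}

/-- Every initial precision message is nonnegative; the initial potential messages are
unrestricted. The all-zero initialization is an example. -/
def FMPMessages.NonnegPrecision {V : Type*} {F : Finset V} (m : FMPMessages F) : Prop :=
  (∀ i j, 0 ≤ m.base.dJ i j) ∧ (∀ p i j, 0 ≤ (m.gain p).dJ i j) ∧ (∀ i j, 0 ≤ m.second.dJ i j)

namespace ApproxFMP

variable {V : Type*} [Fintype V] [DecidableEq V] (M : GaussianGraphicalModel V) (F : Finset V)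

/-- The pseudo-tree, i.e. the graph on the non-feedback nodes. -/
def treeGraph : SimpleGraph {i // i ∉ F} := remainingGraph M.graph F

/-- The information matrix restricted to the non-feedback nodes. -/
def treeJ : Matrix {i // i ∉ F} {i // i ∉ F} ℝ := M.J.submatrix Subtype.val Subtype.val

/-- The potential vector restricted to the non-feedback nodes. -/
def treeh (i : {i // i ∉ F}) : ℝ := M.h i

/-- Step 1: the extra potential vector `h^p = J_{T,p}`. -/
def gainPotential (p : {p // p ∈ F}) (i : {i // i ∉ F}) : ℝ := M.J i p

/-- Step 2: the partial variances. -/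
def partialVariance (m : FMPMessages F) (i : {i // i ∉ F}) : ℝ :=
  LBP.variance (treeGraph M F) (treeJ M F) m.base i

/-- Step 2: the partial means. -/
def partialMean (m : FMPMessages F) (i : {i // i ∉ F}) : ℝ :=
  LBP.mean (treeGraph M F) (treeJ M F) (treeh M F) m.base i

/-- Step 2: the feedback gains `g^p_i`. -/
def feedbackGain (m : FMPMessages F) (p : {p // p ∈ F}) (i : {i // i ∉ F}) : ℝ :=
  LBP.mean (treeGraph M F) (treeJ M F) (gainPotential M F p) (m.gain p) i

open Classical in
/-- Step 3: the information matrix `Ĵ_F` of the small problem on the feedback nodes. -/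
def feedbackJ (m : FMPMessages F) : Matrix {p // p ∈ F} {p // p ∈ F} ℝ :=
  Matrix.of fun p q =>
    M.J p q - ∑ j ∈ Finset.univ.filter (fun j : {i // i ∉ F} => M.graph.Adj p j),
      M.J p j * feedbackGain M F m q j

open Classical in
/-- Step 3: the potential vector `ĥ_F` of the small problem on the feedback nodes. -/
def feedbackh (m : FMPMessages F) (p : {p // p ∈ F}) : ℝ :=
  M.h p - ∑ j ∈ Finset.univ.filter (fun j : {i // i ∉ F} => M.graph.Adj p j),
      M.J p j * partialMean M F m j

/-- Step 3: the covariance `P_F = Ĵ_F⁻¹` of the feedback nodes. -/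
def feedbackCov (m : FMPMessages F) : Matrix {p // p ∈ F} {p // p ∈ F} ℝ :=
  (feedbackJ M F m)⁻¹

/-- Step 3: the means `μ_F = Ĵ_F⁻¹ ĥ_F` of the feedback nodes. -/
def feedbackMean (m : FMPMessages F) : {p // p ∈ F} → ℝ :=
  (feedbackCov M F m).mulVec (feedbackh M F m)

open Classical in
/-- Step 4: the revised potential vector on the non-feedback nodes. -/
def revisedh (m : FMPMessages F) (i : {i // i ∉ F}) : ℝ :=
  M.h i - ∑ j ∈ Finset.univ.filter (fun j : {p // p ∈ F} => M.graph.Adj i j),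
      M.J i j * feedbackMean M F m j

/-- The means returned by the algorithm (Step 3 on `F`, Step 5 off `F`). -/
def outputMean (m : FMPMessages F) (i : V) : ℝ :=
  if hi : i ∈ F then feedbackMean M F m ⟨i, hi⟩
  else LBP.mean (treeGraph M F) (treeJ M F) (revisedh M F m) m.second ⟨i, hi⟩

/-- The variances returned by the algorithm (Step 3 on `F`, Step 5 off `F`). -/
def outputVariance (m : FMPMessages F) (i : V) : ℝ :=
  if hi : i ∈ F then feedbackCov M F m ⟨i, hi⟩ ⟨i, hi⟩
  else partialVariance M F m ⟨i, hi⟩ +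
    ∑ p, ∑ q, feedbackGain M F m p ⟨i, hi⟩ * feedbackCov M F m p q * feedbackGain M F m q ⟨i, hi⟩

/-- Approximate FMP with feedback nodes `F`, with its LBP runs initialized at `m₀`, converges to
the means `μ` and variances `P`: all first-round LBP runs converge, the linear system on the
feedback nodes is nonsingular, the second-round LBP run (whose potential is built from the
fixed-point results of the first round) converges, and `μ`, `P` are the resulting values. -/
def ConvergesTo (m₀ : FMPMessages F) (μ P : V → ℝ) : Prop :=
  ∃ m : FMPMessages F,
    LBP.ConvergesTo (treeGraph M F) (treeJ M F) (treeh M F) m₀.base m.base ∧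
    (∀ p, LBP.ConvergesTo (treeGraph M F) (treeJ M F) (gainPotential M F p)
      (m₀.gain p) (m.gain p)) ∧
    IsUnit (feedbackJ M F m).det ∧
    LBP.ConvergesTo (treeGraph M F) (treeJ M F) (revisedh M F m) m₀.second m.second ∧
    μ = outputMean M F m ∧ P = outputVariance M F m

/-- Approximate FMP converges (and hence returns means and variances). -/
def Converges (m₀ : FMPMessages F) : Prop :=
  ∃ μ P : V → ℝ, ConvergesTo M F m₀ μ P

end ApproxFMP

end

/-! Walk-summability amounts to scaled diagonal dominance. If `v i` is the total absolute weight of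
all walks starting at `i`, splitting off the first step gives `∑ₖ |J k i| * v k + 1 ≤ v i`
(`WalkSummable.exists_scaledDominant`), and such dominance passes to induced subgraphs.

Dominance forces LBP to converge. It keeps cavity precisions positive, so precision messages update
monotonically and are squeezed to a limit (`ScaledDominant.exists_tendsto_dJ`). Potential messages
then follow a linear recursion with convergent coefficients, whose limit matrix contracts a weighted
sup norm (`ScaledDominant.potential_contraction`, `exists_tendsto_of_linear_recursion`).

LBP fixed points have exact means (`ConvergesTo.mulVec_mean`). The gains therefore solve their
linear systems exactly, so the feedback matrix is a Schur complement of the positive definite `J`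
and is invertible. -/

/-! ### Linear recursions with contracting limit. -/

open Filter Topology in
theorem tendsto_zero_of_le_mul_add {u δ : ℕ → ℝ} {r : ℝ} (hr0 : 0 ≤ r) (hr1 : r < 1)
    (hu : ∀ t, 0 ≤ u t) (hδ : Tendsto δ atTop (𝓝 0))
    (h : ∀ᶠ t in atTop, u (t + 1) ≤ r * u t + δ t) : Tendsto u atTop (𝓝 0) := by
  rw [Metric.tendsto_atTop]
  intro ε hε
  have h1r : 0 < 1 - r := by linarith
  -- This bound makes `ε / 2` the fixed point of `s ↦ r * s + (1 - r) * (ε / 2)`.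
  have hev : ∀ᶠ t in atTop, δ t < (1 - r) * (ε / 2) :=
    hδ.eventually_lt_const (by positivity)
  obtain ⟨N, hN⟩ := eventually_atTop.1 (h.and hev)
  have key : ∀ n, u (N + n) ≤ r ^ n * u N + ε / 2 := by
    intro n
    induction n with
    | zero => simp; positivity
    | succ n ih =>
      obtain ⟨h1, h2⟩ := hN (N + n) (by omega)
      have h3 := mul_le_mul_of_nonneg_left ih hr0
      calc u (N + (n + 1)) ≤ r * u (N + n) + δ (N + n) := h1
        _ ≤ r * (r ^ n * u N + ε / 2) + (1 - r) * (ε / 2) := by linarith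
        _ = r ^ (n + 1) * u N + ε / 2 := by ring
  have hpow : Tendsto (fun n => r ^ n * u N) atTop (𝓝 0) := by
    simpa using (tendsto_pow_atTop_nhds_zero_of_lt_one hr0 hr1).mul_const (u N)
  obtain ⟨K, hK⟩ := eventually_atTop.1 (hpow.eventually_lt_const (half_pos hε))
  refine ⟨N + K, fun n hn => ?_⟩
  obtain ⟨k, rfl⟩ := Nat.exists_eq_add_of_le (show N ≤ n by omega)
  have h1 := key k
  have h2 := hK k (by omega)
  rw [Real.dist_eq, sub_zero, abs_of_nonneg (hu _)]
  linarith

/-- A matrix whose entrywise absolute value strictly decreases some positive vector has no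
nonzero fixed vector. -/
theorem eq_zero_of_mulVec_eq_self {ι : Type*} [Fintype ι] (A : Matrix ι ι ℝ) (w : ι → ℝ)
    (hw : ∀ p, 0 < w p) (hA : ∀ p, ∑ q, |A p q| * w q < w p) (x : ι → ℝ)
    (hx : A.mulVec x = x) : x = 0 := by
  by_contra hne
  obtain ⟨p₀, hp₀⟩ := Function.ne_iff.1 hne
  -- At an index attaining the weighted sup norm, the strict row bound contradicts `A x = x`.
  obtain ⟨p, -, hp⟩ := Finset.exists_max_image Finset.univ (fun p => |x p| / w p)
    ⟨p₀, Finset.mem_univ _⟩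
  have hpos : 0 < |x p| / w p :=
    (div_pos (abs_pos.2 hp₀) (hw p₀)).trans_le (hp p₀ (Finset.mem_univ _))
  have hxq : ∀ q, |x q| ≤ |x p| / w p * w q := fun q =>
    (div_le_iff₀ (hw q)).1 (hp q (Finset.mem_univ _))
  have h1 : |x p| ≤ |x p| / w p * ∑ q, |A p q| * w q := by
    calc |x p| = |∑ q, A p q * x q| := by
          conv_lhs => rw [← hx]
          rfl
      _ ≤ ∑ q, |A p q * x q| := Finset.abs_sum_le_sum_abs _ _
      _ ≤ ∑ q, |x p| / w p * (|A p q| * w q) := Finset.sum_le_sum fun q _ => by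
          rw [abs_mul]
          nlinarith [mul_le_mul_of_nonneg_left (hxq q) (abs_nonneg (A p q))]
      _ = _ := (Finset.mul_sum _ _ _).symm
  have h2 := mul_lt_mul_of_pos_left (hA p) hpos
  rw [div_mul_cancel₀ _ (hw p).ne'] at h2
  linarith

open Filter Topology in
/-- A linear recursion with convergent coefficients converges if the limit matrix is a contraction
in a weighted supremum norm. -/
theorem exists_tendsto_of_linear_recursion {ι : Type*} [Fintype ι]
    (A : ℕ → Matrix ι ι ℝ) (B : Matrix ι ι ℝ) (c : ℕ → ι → ℝ) (d : ι → ℝ) (w : ι → ℝ)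
    (hA : ∀ p q, Tendsto (fun t => A t p q) atTop (𝓝 (B p q)))
    (hc : ∀ p, Tendsto (fun t => c t p) atTop (𝓝 (d p)))
    (hw : ∀ p, 0 < w p) (hB : ∀ p, ∑ q, |B p q| * w q < w p)
    (x : ℕ → ι → ℝ) (hx : ∀ t p, x (t + 1) p = ∑ q, A t p q * x t q + c t p) :
    ∃ y : ι → ℝ, ∀ p, Tendsto (fun t => x t p) atTop (𝓝 (y p)) := by
  rcases isEmpty_or_nonempty ι with hι | hι
  · exact ⟨0, fun p => isEmptyElim p⟩
  -- The candidate limit solves `y = B y + d`; in finite dimension, injectivity of `1 - B` suffices.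
  obtain ⟨y, hy⟩ : ∃ y : ι → ℝ, ((LinearMap.id : (ι → ℝ) →ₗ[ℝ] ι → ℝ) - B.mulVecLin) y = d := by
    refine LinearMap.surjective_of_injective (LinearMap.ker_eq_bot.1 ?_) d
    rw [LinearMap.ker_eq_bot']
    intro z hz
    refine eq_zero_of_mulVec_eq_self B w hw hB z ?_
    simpa [sub_eq_zero, eq_comm] using hz
  have hy' : ∀ p, y p = ∑ q, B p q * y q + d p := fun p => by
    have := congrFun hy p
    simp only [LinearMap.sub_apply, LinearMap.id_apply, Matrix.mulVecLin_apply, Pi.sub_apply,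
      Matrix.mulVec, dotProduct] at this
    linarith
  refine ⟨y, ?_⟩
  obtain ⟨r, hr0, hr1, hr⟩ : ∃ r : ℝ, 0 ≤ r ∧ r < 1 ∧ ∀ p, ∑ q, |B p q| * w q < r * w p := by
    have hlt : ∀ p, ∀ᶠ r in 𝓝[<] (1 : ℝ), ∑ q, |B p q| * w q < r * w p := fun p => by
      have : Tendsto (fun r : ℝ => r * w p) (𝓝[<] 1) (𝓝 (1 * w p)) :=
        (tendsto_id.mul_const _).mono_left nhdsWithin_le_nhds
      exact this.eventually_const_lt (by simpa using hB p)
    have h0 : ∀ᶠ r in 𝓝[<] (1 : ℝ), 0 ≤ r :=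
      eventually_nhdsWithin_of_eventually_nhds (eventually_ge_nhds one_pos)
    obtain ⟨r, h1, h2, h3⟩ :=
      (h0.and ((eventually_all.2 hlt).and self_mem_nhdsWithin)).exists
    exact ⟨r, h1, h3, h2⟩
  have hAr : ∀ᶠ t in atTop, ∀ p, ∑ q, |A t p q| * w q < r * w p :=
    eventually_all.2 fun p => (tendsto_finsetSum _ fun q _ =>
      ((hA p q).abs.mul_const (w q))).eventually_lt_const (hr p)
  -- The defect of `y` in the recursion at time `t`.
  set ε : ℕ → ι → ℝ := fun t p => ∑ q, (A t p q - B p q) * y q + (c t p - d p) with hε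
  have hε0 : ∀ p, Tendsto (fun t => ε t p) atTop (𝓝 0) := fun p => by
    have h1 : Tendsto (fun t => ∑ q, (A t p q - B p q) * y q) atTop (𝓝 0) := by
      simpa using tendsto_finsetSum Finset.univ fun q _ =>
        ((hA p q).sub_const (B p q)).mul_const (y q)
    simpa using h1.add ((hc p).sub_const (d p))
  have herr : ∀ t p, x (t + 1) p - y p = ∑ q, A t p q * (x t q - y q) + ε t p := fun t p => by
    rw [hx, hy' p, hε]
    simp only [mul_sub, sub_mul, Finset.sum_sub_distrib]
    ring
  set u : ℕ → ℝ := fun t => Finset.univ.sup' Finset.univ_nonempty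
    (fun p => |x t p - y p| / w p) with hu
  have hle : ∀ t p, |x t p - y p| ≤ u t * w p := fun t p => by
    rw [← div_le_iff₀ (hw p)]
    exact Finset.le_sup' (fun p => |x t p - y p| / w p) (Finset.mem_univ p)
  have hu0 : ∀ t, 0 ≤ u t := fun t => by
    obtain ⟨p⟩ := hι
    exact nonneg_of_mul_nonneg_left ((abs_nonneg _).trans (hle t p)) (hw p)
  have hlim : Tendsto u atTop (𝓝 0) := by
    refine tendsto_zero_of_le_mul_add (δ := fun t => ∑ p, |ε t p| / w p) hr0 hr1 hu0 ?_ ?_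
    · simpa using tendsto_finsetSum Finset.univ fun p _ => ((hε0 p).abs.div_const (w p))
    · filter_upwards [hAr] with t ht
      refine Finset.sup'_le _ _ fun p _ => ?_
      rw [div_le_iff₀ (hw p), herr]
      have h1 : |∑ q, A t p q * (x t q - y q)| ≤ u t * ∑ q, |A t p q| * w q := by
        rw [Finset.mul_sum]
        refine (Finset.abs_sum_le_sum_abs _ _).trans (Finset.sum_le_sum fun q _ => ?_)
        rw [abs_mul]
        nlinarith [mul_le_mul_of_nonneg_left (hle t q) (abs_nonneg (A t p q))]
      have h2 := mul_le_mul_of_nonneg_left (ht p).le (hu0 t)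
      have h3 : |ε t p| ≤ (∑ p, |ε t p| / w p) * w p := by
        rw [← div_le_iff₀ (hw p)]
        exact Finset.single_le_sum (f := fun p => |ε t p| / w p)
          (fun q _ => div_nonneg (abs_nonneg _) (hw q).le) (Finset.mem_univ p)
      have := abs_add_le (∑ q, A t p q * (x t q - y q)) (ε t p)
      linarith
  intro p
  rw [tendsto_iff_dist_tendsto_zero]
  refine squeeze_zero (fun _ => dist_nonneg) (fun t => ?_) (by simpa using hlim.mul_const (w p))
  rw [Real.dist_eq]
  exact hle t p

/-! ### Fixed points of belief propagation. -/

namespace LBP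

variable {V : Type*} [Fintype V]

theorem cavity_add {G : SimpleGraph V} (x : V → ℝ) (m : V → V → ℝ) {i j : V}
    (hij : G.Adj i j) : cavity G x m i j + m j i = node G x m i := by
  classical
  unfold cavity node
  have : (Finset.univ.filter fun k => G.Adj i k) =
      insert j (Finset.univ.filter fun k => G.Adj i k ∧ k ≠ j) := by
    ext k
    by_cases hk : k = j <;> simp [hk, hij]
  rw [add_assoc]
  congr 1
  convert (Finset.sum_insert (f := fun k => m k i) (a := j)
    (s := Finset.univ.filter fun k => G.Adj i k ∧ k ≠ j) (by simp)).symm using 1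
  · simp only [add_comm (m j i)]
  · rw [this]

theorem cavity_mono {G : SimpleGraph V} (x : V → ℝ) {m m' : V → V → ℝ} (i j : V)
    (h : ∀ k, G.Adj k i → m k i ≤ m' k i) : cavity G x m i j ≤ cavity G x m' i j := by
  classical
  unfold cavity
  gcongr with k hk
  exact h k (by simpa using (Finset.mem_filter.1 hk).2.1.symm)

open Filter Topology in
theorem tendsto_cavity {G : SimpleGraph V} (x : V → ℝ) {m : ℕ → V → V → ℝ} {m' : V → V → ℝ}
    (h : ∀ i j, G.Adj i j → Tendsto (fun t => m t i j) atTop (𝓝 (m' i j))) (i j : V) :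
    Tendsto (fun t => cavity G x (m t) i j) atTop (𝓝 (cavity G x m' i j)) := by
  classical
  unfold cavity
  refine tendsto_const_nhds.add (tendsto_finsetSum _ fun k hk => h k i ?_)
  exact (Finset.mem_filter.1 hk).2.1.symm

section Convergence

variable {G : SimpleGraph V} {J : Matrix V V ℝ} {h : V → ℝ}

open Filter Topology in
theorem ConvergesTo.dJ_eq {m₀ m : Messages V} (H : ConvergesTo G J h m₀ m) {i j : V}
    (hij : G.Adj i j) : m.dJ i j = (update G J h m).dJ i j := by
  refine tendsto_nhds_unique ((tendsto_add_atTop_iff_nat 1).2 (H.tendsto_dJ i j hij)) ?_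
  exact (((tendsto_cavity J.diag H.tendsto_dJ i j).inv₀ (H.limit_ne_zero i j hij)).const_mul
    _).mul_const _

open Filter Topology in
theorem ConvergesTo.dh_eq {m₀ m : Messages V} (H : ConvergesTo G J h m₀ m) {i j : V}
    (hij : G.Adj i j) : m.dh i j = (update G J h m).dh i j := by
  refine tendsto_nhds_unique ((tendsto_add_atTop_iff_nat 1).2 (H.tendsto_dh i j hij)) ?_
  exact (((tendsto_cavity J.diag H.tendsto_dJ i j).inv₀ (H.limit_ne_zero i j hij)).const_mul
    _).mul (tendsto_cavity h H.tendsto_dh i j)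

/-- The means at a fixed point of belief propagation are exact. -/
theorem ConvergesTo.mulVec_mean {m₀ m : Messages V} (H : ConvergesTo G J h m₀ m)
    (hsymm : ∀ i j, J i j = J j i) (hJ : ∀ i j, i ≠ j → ¬ G.Adj i j → J i j = 0) :
    J.mulVec (mean G J h m) = h := by
  classical
  -- The message equations in both directions of an edge combine into this identity; summed over
  -- neighbours, it turns the node equation at `j` into row `j` of `J μ = h`.
  have edge : ∀ j i, G.Adj j i →
      J j i * mean G J h m i = m.dJ i j * mean G J h m j - m.dh i j := by
    intro j i hji
    have hij := hji.symm
    have ha := H.limit_ne_zero i j hij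
    have hb := H.limit_ne_zero j i hji
    have hni := H.node_ne_zero i
    have hnj := H.node_ne_zero j
    have e1 := H.dJ_eq hij
    have e2 := H.dJ_eq hji
    have e3 := H.dh_eq hij
    have e4 := H.dh_eq hji
    have e5 := cavity_add J.diag m.dJ hij
    have e6 := cavity_add J.diag m.dJ hji
    have e7 := cavity_add h m.dh hij
    have e8 := cavity_add h m.dh hji
    simp only [update] at e1 e2 e3 e4
    simp only [mean]
    rw [← e7, ← e8]
    rw [← e5] at hni ⊢
    rw [← e6] at hnj ⊢
    rw [e1, e3]
    rw [e1] at hnj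
    rw [e2] at hni ⊢
    rw [e4]
    rw [hsymm i j] at *
    generalize cavity G J.diag m.dJ i j = a at *
    generalize cavity G J.diag m.dJ j i = b at *
    generalize cavity G h m.dh i j = p at *
    generalize cavity G h m.dh j i = q at *
    generalize J j i = r at *
    have k1 : a + -r * b⁻¹ * r = (a * b - r ^ 2) / b := by field_simp; ring
    have k2 : b + -r * a⁻¹ * r = (a * b - r ^ 2) / a := by field_simp; ring
    rw [k1] at hni ⊢
    rw [k2] at hnj ⊢
    -- The determinant of the two-node system on the edge, nonzero because the node precision is.
    have hd : a * b - r ^ 2 ≠ 0 := fun h0 => hni (by rw [h0, zero_div])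
    field_simp
    ring
  funext j
  have hsum : ∑ i, J j i * mean G J h m i =
      J j j * mean G J h m j + ∑ i with G.Adj j i, J j i * mean G J h m i := by
    rw [← Finset.add_sum_erase _ _ (Finset.mem_univ j)]
    congr 1
    symm
    refine Finset.sum_subset (fun i hi => ?_) fun i hi hi' => ?_
    · simpa using (Finset.mem_filter.1 hi).2.ne'
    · rw [hJ j i (Finset.ne_of_mem_erase hi).symm (by simpa using hi'), zero_mul]
  have hfix : node G J.diag m.dJ j * mean G J h m j = node G h m.dh j := by
    rw [mean, mul_inv_cancel_left₀ (H.node_ne_zero j)]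
  rw [Matrix.mulVec, dotProduct, hsum,
    Finset.sum_congr rfl fun i hi => edge j i (Finset.mem_filter.1 hi).2,
    Finset.sum_sub_distrib, ← Finset.sum_mul]
  simp only [node, Matrix.diag_apply] at hfix
  linarith

/-! ### Convergence of LBP under scaled dominance. -/

/-- The precision messages are bounded below in terms of the weights `v`. -/
def PrecisionBound (G : SimpleGraph V) (J : Matrix V V ℝ) (v : V → ℝ) (m : V → V → ℝ) : Prop :=
  ∀ i j, G.Adj i j → -(|J i j| * v i) ≤ m i j * v j

/-- Strict diagonal dominance of `J` along the graph after scaling by positive weights `v`. -/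
structure ScaledDominant (G : SimpleGraph V) (J : Matrix V V ℝ) (v : V → ℝ) : Prop where
  symm : ∀ i j, J i j = J j i
  ne_zero : ∀ i j, G.Adj i j → J i j ≠ 0
  pos : ∀ i, 0 < v i
  lt : ∀ i, node G 0 (fun k i => |J k i| * v k) i < J i i * v i

variable {v : V → ℝ} (D : ScaledDominant G J v) {m : V → V → ℝ}
include D

theorem ScaledDominant.node_pos (hm : PrecisionBound G J v m) (i : V) :
    0 < node G J.diag m i := by
  classical
  have h1 := D.lt i
  have h2 : -node G 0 (fun k i => |J k i| * v k) i ≤ (∑ k with G.Adj i k, m k i) * v i := by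
    rw [node, Pi.zero_apply, zero_add, ← Finset.sum_neg_distrib, Finset.sum_mul]
    exact Finset.sum_le_sum fun k hk => hm k i (Finset.mem_filter.1 hk).2.symm
  refine pos_of_mul_pos_left (b := v i) ?_ (D.pos i).le
  simp only [node, Matrix.diag_apply, add_mul]
  linarith

/-- Omitting neighbour `j` from the dominance inequality at `i` leaves its term `|J j i| * v j` to
spare. This slack makes `PrecisionBound` invariant under updates. -/
theorem ScaledDominant.lt_cavity (hm : PrecisionBound G J v m) {i j : V} (hij : G.Adj i j) :
    |J i j| * v j < cavity G J.diag m i j * v i := by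
  classical
  have h1 := D.lt i
  rw [← cavity_add 0 (fun k i => |J k i| * v k) hij] at h1
  have h2 : -cavity G 0 (fun k i => |J k i| * v k) i j ≤
      (∑ k with G.Adj i k ∧ k ≠ j, m k i) * v i := by
    rw [cavity, Pi.zero_apply, zero_add, ← Finset.sum_neg_distrib, Finset.sum_mul]
    exact Finset.sum_le_sum fun k hk => hm k i (Finset.mem_filter.1 hk).2.1.symm
  rw [D.symm i j]
  simp only [cavity, Matrix.diag_apply, add_mul] at h1 h2 ⊢
  linarith

theorem ScaledDominant.cavity_pos (hm : PrecisionBound G J v m) {i j : V} (hij : G.Adj i j) :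
    0 < cavity G J.diag m i j :=
  pos_of_mul_pos_left ((mul_nonneg (abs_nonneg _) (D.pos j).le).trans_lt (D.lt_cavity hm hij))
    (D.pos i).le

theorem ScaledDominant.update_dJ (m : Messages V) (i j : V) :
    (update G J h m).dJ i j = -(|J i j| ^ 2 * (cavity G J.diag m.dJ i j)⁻¹) := by
  simp only [sq_abs, update, D.symm j i]
  ring

theorem ScaledDominant.precisionBound_update {m : Messages V} (hm : PrecisionBound G J v m.dJ) :
    PrecisionBound G J v (update G J h m).dJ := by
  intro i j hij
  have h1 := D.lt_cavity hm hij
  have h2 := D.cavity_pos hm hij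
  rw [D.update_dJ, neg_mul, neg_le_neg_iff, mul_right_comm, ← div_eq_mul_inv, div_le_iff₀ h2]
  nlinarith [mul_le_mul_of_nonneg_left h1.le (abs_nonneg (J i j))]

theorem ScaledDominant.update_dJ_nonpos {m : Messages V} (hm : PrecisionBound G J v m.dJ)
    {i j : V} (hij : G.Adj i j) : (update G J h m).dJ i j ≤ 0 := by
  rw [D.update_dJ, neg_nonpos]
  have := D.cavity_pos hm hij
  positivity

/-- The map `c ↦ -|J i j| ^ 2 / c` is increasing for `c > 0`, so positivity of the smaller cavity is
enough. -/
theorem ScaledDominant.update_dJ_mono {h' : V → ℝ} {m m' : Messages V}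
    (hm : PrecisionBound G J v m.dJ)
    (hle : ∀ i j, G.Adj i j → m.dJ i j ≤ m'.dJ i j) {i j : V} (hij : G.Adj i j) :
    (update G J h m).dJ i j ≤ (update G J h' m').dJ i j := by
  have h1 := D.cavity_pos hm hij
  have h2 := cavity_mono J.diag i j fun k hk => hle k i hk
  rw [D.update_dJ, D.update_dJ, neg_le_neg_iff]
  gcongr

theorem ScaledDominant.precisionBound_of_nonneg (hm : ∀ i j, 0 ≤ m i j) :
    PrecisionBound G J v m := fun i j _ => by
  have h1 := mul_nonneg (hm i j) (D.pos j).le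
  have h2 := mul_nonneg (abs_nonneg (J i j)) (D.pos i).le
  linarith

theorem ScaledDominant.precisionBound_iterate {m : Messages V} (hm : PrecisionBound G J v m.dJ)
    (t : ℕ) : PrecisionBound G J v (iterate G J h m t).dJ := by
  induction t with
  | zero => exact hm
  | succ t ih => exact D.precisionBound_update ih

-- The zero-started run decreases and is bounded below; any nonnegative start is squeezed between
-- that run and its shift by one step.
open Filter Topology in
theorem ScaledDominant.exists_tendsto_dJ (m₀ : Messages V) (hm₀ : ∀ i j, 0 ≤ m₀.dJ i j) :
    ∃ z : V → V → ℝ, PrecisionBound G J v z ∧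
      ∀ i j, G.Adj i j → Tendsto (fun t => (iterate G J h m₀ t).dJ i j) atTop (𝓝 (z i j)) := by
  set z := iterate G J h ⟨0, 0⟩ with hz
  have hPz : ∀ t, PrecisionBound G J v (z t).dJ :=
    D.precisionBound_iterate (D.precisionBound_of_nonneg fun _ _ => le_rfl)
  have hPd : ∀ t, PrecisionBound G J v (iterate G J h m₀ t).dJ :=
    D.precisionBound_iterate (D.precisionBound_of_nonneg hm₀)
  have hstep : ∀ t i j, G.Adj i j → (z (t + 1)).dJ i j ≤ (z t).dJ i j := by
    intro t
    induction t with
    | zero => exact fun i j hij => D.update_dJ_nonpos (hPz 0) hij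
    | succ t ih => exact fun i j hij => D.update_dJ_mono (hPz _) ih hij
  have hlow : ∀ t i j, G.Adj i j → (z t).dJ i j ≤ (iterate G J h m₀ t).dJ i j := by
    intro t
    induction t with
    | zero => exact fun i j _ => hm₀ i j
    | succ t ih => exact fun i j hij => D.update_dJ_mono (hPz _) ih hij
  -- The shift is needed because the start may exceed `0`, whereas every updated message is
  -- nonpositive.
  have hup : ∀ t i j, G.Adj i j → (iterate G J h m₀ (t + 1)).dJ i j ≤ (z t).dJ i j := by
    intro t
    induction t with
    | zero => exact fun i j hij => D.update_dJ_nonpos (hPd 0) hij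
    | succ t ih => exact fun i j hij => D.update_dJ_mono (hPd _) ih hij
  have hlim : ∀ i j, ∃ l, G.Adj i j → Tendsto (fun t => (z t).dJ i j) atTop (𝓝 l) := by
    intro i j
    by_cases hij : G.Adj i j
    · refine ⟨_, fun _ => tendsto_atTop_ciInf
        (antitone_nat_of_succ_le fun t => hstep t i j hij) ⟨-(|J i j| * v i) / v j, ?_⟩⟩
      rintro _ ⟨t, rfl⟩
      exact (div_le_iff₀ (D.pos j)).2 (hPz t i j hij)
    · exact ⟨0, fun h => (hij h).elim⟩
  choose l hl using hlim
  refine ⟨l, fun i j hij => ?_, fun i j hij => ?_⟩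
  · exact ge_of_tendsto' ((hl i j hij).mul_const (v j)) fun t => hPz t i j hij
  · rw [← tendsto_add_atTop_iff_nat 1]
    exact tendsto_of_tendsto_of_tendsto_of_le_of_le
      ((tendsto_add_atTop_iff_nat 1).2 (hl i j hij)) (hl i j hij)
      (fun t => hlow (t + 1) i j hij) (fun t => hup t i j hij)

/-- At a fixed point, `|J i j| v i + ΔJ_{i→j} v j` strictly dominates the absolute value of the
linear recursion of the potential messages. -/
theorem ScaledDominant.potential_contraction (hm : PrecisionBound G J v m)
    (hfix : ∀ i j, G.Adj i j → m i j = -(|J i j| ^ 2 * (cavity G J.diag m i j)⁻¹))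
    {i j : V} (hij : G.Adj i j) :
    |J i j| * (cavity G J.diag m i j)⁻¹ *
      cavity G 0 (fun k i => |J k i| * v k + m k i * v i) i j < |J i j| * v i + m i j * v j := by
  classical
  have hc := D.cavity_pos hm hij
  have h1 := D.lt i
  rw [← cavity_add 0 (fun k i => |J k i| * v k) hij] at h1
  have h2 : cavity G 0 (fun k i => |J k i| * v k + m k i * v i) i j <
      cavity G J.diag m i j * v i - |J i j| * v j := by
    rw [D.symm i j]
    simp only [cavity, Matrix.diag_apply, add_mul, Finset.sum_mul, Finset.sum_add_distrib] at h1 ⊢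
    linarith
  have h3 : 0 < |J i j| * (cavity G J.diag m i j)⁻¹ :=
    mul_pos (abs_pos.2 (D.ne_zero i j hij)) (inv_pos.2 hc)
  refine (mul_lt_mul_of_pos_left h2 h3).trans_eq ?_
  -- The spare term `|J i j| * v j`, once scaled, is exactly the fixed-point message: hence this
  -- choice of weight.
  have h4 : |J i j| * (cavity G J.diag m i j)⁻¹ * (cavity G J.diag m i j * v i - |J i j| * v j) =
      |J i j| * v i + -(|J i j| ^ 2 * (cavity G J.diag m i j)⁻¹) * v j := by
    field_simp
    ring
  rw [h4, ← hfix i j hij]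

-- Potential messages are treated as one vector indexed by `V × V`, with non-edges padded by zero
-- rows and weight `1`.
open Filter Topology in
theorem ScaledDominant.exists_convergesTo (h : V → ℝ) (m₀ : Messages V)
    (hm₀ : ∀ i j, 0 ≤ m₀.dJ i j) : ∃ m, ConvergesTo G J h m₀ m := by
  classical
  obtain ⟨z, hz, hlim⟩ := D.exists_tendsto_dJ (h := h) m₀ hm₀
  have hP : ∀ t, PrecisionBound G J v (iterate G J h m₀ t).dJ :=
    D.precisionBound_iterate (D.precisionBound_of_nonneg hm₀)
  have hcav : ∀ i j, G.Adj i j →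
      Tendsto (fun t => (cavity G J.diag (iterate G J h m₀ t).dJ i j)⁻¹) atTop
        (𝓝 (cavity G J.diag z i j)⁻¹) := fun i j hij =>
    (tendsto_cavity J.diag hlim i j).inv₀ (D.cavity_pos hz hij).ne'
  have hfix : ∀ i j, G.Adj i j → z i j = -(|J i j| ^ 2 * (cavity G J.diag z i j)⁻¹) := by
    intro i j hij
    refine tendsto_nhds_unique ((tendsto_add_atTop_iff_nat 1).2 (hlim i j hij)) ?_
    simp only [iterate, D.update_dJ]
    exact ((hcav i j hij).const_mul _).neg
  -- Non-backtracking incidence: message `q` feeds the update of message `p`.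
  let E : V × V → V × V → Prop := fun p q => G.Adj p.1 p.2 ∧ q.2 = p.1 ∧ G.Adj p.1 q.1 ∧ q.1 ≠ p.2
  let a : (V → V → ℝ) → V × V → ℝ := fun m p => -(J p.2 p.1) * (cavity G J.diag m p.1 p.2)⁻¹
  let A : (V → V → ℝ) → Matrix (V × V) (V × V) ℝ := fun m p q => if E p q then a m p else 0
  let c : (V → V → ℝ) → V × V → ℝ := fun m p => if G.Adj p.1 p.2 then a m p * h p.1 else 0
  have hsum : ∀ (p : V × V) (s : ℝ) (f : V → V → ℝ), G.Adj p.1 p.2 →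
      (∑ q, (if E p q then s else 0) * f q.1 q.2) = s * cavity G 0 f p.1 p.2 := by
    intro p s f hp
    rw [Fintype.sum_prod_type, cavity, Pi.zero_apply, zero_add, Finset.mul_sum,
      Finset.sum_filter]
    refine Finset.sum_congr rfl fun k _ => ?_
    rw [Finset.sum_eq_single p.1 (fun l _ hl => by simp [E, hl]) (by simp)]
    simp [E, hp]
  have ha : ∀ p : V × V, G.Adj p.1 p.2 →
      Tendsto (fun t => a (iterate G J h m₀ t).dJ p) atTop (𝓝 (a z p)) := fun p hp =>
    (hcav p.1 p.2 hp).const_mul _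
  obtain ⟨y, hy⟩ := exists_tendsto_of_linear_recursion
    (fun t => A (iterate G J h m₀ t).dJ) (A z) (fun t => c (iterate G J h m₀ t).dJ) (c z)
    (fun p => if G.Adj p.1 p.2 then |J p.1 p.2| * v p.1 + z p.1 p.2 * v p.2 else 1)
    (fun p q => by
      by_cases hE : E p q
      · simpa only [A, if_pos hE] using ha p hE.1
      · simpa only [A, if_neg hE] using tendsto_const_nhds)
    (fun p => by
      by_cases hp : G.Adj p.1 p.2
      · simpa only [c, if_pos hp] using (ha p hp).mul_const _
      · simpa only [c, if_neg hp] using tendsto_const_nhds)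
    (fun p => by
      by_cases hp : G.Adj p.1 p.2
      · rw [if_pos hp]
        -- `PrecisionBound` gives only a nonnegative weight; strictness comes from the contraction
        -- inequality, whose left side is nonnegative.
        refine lt_of_le_of_lt ?_ (D.potential_contraction hz hfix hp)
        have h1 := D.cavity_pos hz hp
        have h2 : 0 ≤ cavity G 0 (fun k i => |J k i| * v k + z k i * v i) p.1 p.2 := by
          rw [cavity, Pi.zero_apply, zero_add]
          refine Finset.sum_nonneg fun k hk => ?_
          have := hz k p.1 (Finset.mem_filter.1 hk).2.1.symm
          linarith
        positivity
      · rw [if_neg hp]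
        exact one_pos)
    (fun p => by
      by_cases hp : G.Adj p.1 p.2
      · rw [if_pos hp]
        refine lt_of_eq_of_lt ?_ (D.potential_contraction hz hfix hp)
        rw [← hsum p _ _ hp]
        refine Finset.sum_congr rfl fun q _ => ?_
        by_cases hE : E p q
        · have hq : G.Adj q.1 q.2 := hE.2.1 ▸ hE.2.2.1.symm
          simp only [A, if_pos hE, if_pos hq, a]
          rw [abs_mul, abs_neg, abs_inv, abs_of_pos (D.cavity_pos hz hp), D.symm p.2]
        · simp only [A, if_neg hE, abs_zero, zero_mul]
      · have h0 : ∀ q, A z p q = 0 := fun q => if_neg fun hE => hp hE.1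
        simp [h0, if_neg hp])
    (fun t p => if G.Adj p.1 p.2 then (iterate G J h m₀ t).dh p.1 p.2 else 0)
    (fun t p => by
      by_cases hp : G.Adj p.1 p.2
      · have h1 := hsum p (a (iterate G J h m₀ t).dJ p) (iterate G J h m₀ t).dh hp
        have h2 : ∀ q : V × V, A (iterate G J h m₀ t).dJ p q *
            (if G.Adj q.1 q.2 then (iterate G J h m₀ t).dh q.1 q.2 else 0) =
            (if E p q then a (iterate G J h m₀ t).dJ p else 0) *
              (iterate G J h m₀ t).dh q.1 q.2 := fun q => by
          by_cases hE : E p q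
          · have hq : G.Adj q.1 q.2 := hE.2.1 ▸ hE.2.2.1.symm
            simp only [A, if_pos hE, if_pos hq]
          · simp only [A, if_neg hE, zero_mul]
        rw [Finset.sum_congr rfl fun q _ => h2 q, h1]
        simp only [c, if_pos hp, iterate, update, a, cavity, Pi.zero_apply]
        ring
      · have h0 : ∀ q, A (iterate G J h m₀ t).dJ p q = 0 := fun q => if_neg fun hE => hp hE.1
        simp only [h0, if_neg hp, c, zero_mul, Finset.sum_const_zero, add_zero])
  refine ⟨⟨z, fun i j => y (i, j)⟩, fun t i j hij => (D.cavity_pos (hP t) hij).ne', hlim,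
    fun i j hij => ?_, fun i j hij => (D.cavity_pos hz hij).ne', fun i => (D.node_pos hz i).ne'⟩
  simpa only [if_pos hij] using hy (i, j)

end Convergence

end LBP

/-! ### From walk-sums to scaled dominance. -/

namespace GaussianGraphicalModel

variable {V : Type*} [Fintype V] [DecidableEq V] (M : GaussianGraphicalModel V)

/-- The sum of the absolute weights of all walks from `i` to `j`. -/
noncomputable def absWalkSum (i j : V) : ℝ := ∑' w : M.graph.Walk i j, |walkWeight M.edgeWeight w|

variable {M} (hWS : M.WalkSummable)
include hWS

-- Nontrivial walks are a first edge followed by a walk, and the weight factors accordingly; the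
-- trivial walk contributes `1` when `i = j`.
open Classical in
theorem WalkSummable.sum_absWalkSum_add_le (i j : V) :
    ∑ k : {k // M.graph.Adj i k}, |M.edgeWeight i k| * M.absWalkSum k j +
      (if i = j then 1 else 0) ≤ M.absWalkSum i j := by
  let φ : (k : V) → M.graph.Walk k j → ℝ := fun _ w => |walkWeight M.edgeWeight w|
  have hφ : ∀ k, Summable (φ k) := fun k => (hWS k j).abs
  let g : M.graph.Walk i j → ℝ := fun w => if w.Nil then 0 else φ i w
  have hg0 : ∀ w, 0 ≤ g w := fun w => by
    simp only [g]; split_ifs <;> [rfl; exact abs_nonneg _]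
  have hgφ : ∀ w, g w ≤ φ i w := fun w => by
    simp only [g]; split_ifs <;> [exact abs_nonneg _; rfl]
  have hg : Summable g := Summable.of_nonneg_of_le hg0 hgφ (hφ i)
  let f : (Σ k : {k // M.graph.Adj i k}, M.graph.Walk k j) → M.graph.Walk i j :=
    fun s => .cons s.1.2 s.2
  have hf : Function.Injective f := by
    rintro ⟨⟨k, hk⟩, w⟩ ⟨⟨l, hl⟩, w'⟩ h
    simp only [f, SimpleGraph.Walk.cons.injEq] at h
    obtain ⟨rfl, h⟩ := h
    rw [eq_of_heq h]
  have h1 : ∑ k : {k // M.graph.Adj i k}, |M.edgeWeight i k| * M.absWalkSum k j =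
      ∑' s, g (f s) := by
    refine Eq.symm ((hg.comp_injective hf).tsum_sigma.trans ?_)
    rw [tsum_fintype]
    refine Finset.sum_congr rfl fun k _ => ?_
    rw [absWalkSum, ← tsum_mul_left]
    refine tsum_congr fun w => ?_
    simp [g, f, φ, walkWeight, abs_mul]
  have h2 : ∑' s, g (f s) ≤ ∑' w, g w := tsum_comp_le_tsum_of_inj hg hg0 hf
  have h3 : (if i = j then (1 : ℝ) else 0) ≤ ∑' w, (φ i w - g w) := by
    have hs : Summable fun w => φ i w - g w := (hφ i).sub hg
    split_ifs with h
    · subst h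
      refine le_trans ?_ (hs.le_tsum .nil fun w _ => sub_nonneg.2 (hgφ w))
      simp [φ, g, walkWeight]
    · exact tsum_nonneg fun w => sub_nonneg.2 (hgφ w)
  rw [(hφ i).tsum_sub hg] at h3
  rw [h1]
  change _ ≤ ∑' w, φ i w
  linarith

/-- A normalized walk-summable model is strictly diagonally dominant after a positive diagonal
scaling. -/
theorem WalkSummable.exists_scaledDominant (hnorm : ∀ i, M.J i i = 1) :
    ∃ v, LBP.ScaledDominant M.graph M.J v := by
  classical
  have hnn : ∀ i j, 0 ≤ M.absWalkSum i j := fun i j => tsum_nonneg fun _ => abs_nonneg _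
  have hsymm : ∀ i j, M.J i j = M.J j i := fun i j => by
    simpa using M.posDef.isHermitian.apply j i
  have key : ∀ i, LBP.node M.graph 0 (fun k i => |M.J k i| * ∑ j, M.absWalkSum k j) i + 1 ≤
      ∑ j, M.absWalkSum i j := fun i => by
    have h := Finset.sum_le_sum fun j (_ : j ∈ Finset.univ) => hWS.sum_absWalkSum_add_le i j
    rw [Finset.sum_add_distrib, Finset.sum_comm, Finset.sum_ite_eq, if_pos (Finset.mem_univ i)]
      at h
    refine le_trans (le_of_eq ?_) h
    rw [LBP.node, Pi.zero_apply, zero_add,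
      Finset.sum_subtype (p := fun k => M.graph.Adj i k) _ (by simp)]
    congr 1
    refine Finset.sum_congr rfl fun k _ => ?_
    rw [← Finset.mul_sum, edgeWeight, Matrix.sub_apply, Matrix.one_apply_ne k.2.ne, zero_sub,
      abs_neg, hsymm]
  have hnode : ∀ i, 0 ≤ LBP.node M.graph 0 (fun k i => |M.J k i| * ∑ j, M.absWalkSum k j) i :=
    fun i => by
      rw [LBP.node, Pi.zero_apply, zero_add]
      exact Finset.sum_nonneg fun k _ =>
        mul_nonneg (abs_nonneg _) (Finset.sum_nonneg fun j _ => hnn k j)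
  -- The trivial walk's `+ 1` in `key` makes dominance strict and the weights positive.
  refine ⟨fun i => ∑ j, M.absWalkSum i j, hsymm, fun i j hij => (M.adj_iff i j hij.ne).1 hij,
    fun i => ?_, fun i => ?_⟩
  · have := key i
    have := hnode i
    linarith
  · rw [hnorm, one_mul]
    have := key i
    linarith

end GaussianGraphicalModel

/-- Scaled diagonal dominance passes to induced subgraphs. -/
theorem LBP.ScaledDominant.comap_subtype {V : Type*} [Fintype V] {G : SimpleGraph V}
    {J : Matrix V V ℝ} {v : V → ℝ} (D : LBP.ScaledDominant G J v) (p : V → Prop)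
    [DecidablePred p] :
    LBP.ScaledDominant (G.comap (Subtype.val : {i // p i} → V))
      (J.submatrix Subtype.val Subtype.val) (fun i => v i) where
  symm i j := D.symm i j
  ne_zero i j hij := D.ne_zero i j hij
  pos i := D.pos i
  lt i := by
    classical
    refine lt_of_le_of_lt ?_ (D.lt i)
    simp only [LBP.node, Pi.zero_apply, zero_add, Matrix.submatrix_apply, SimpleGraph.comap_adj]
    refine (Finset.sum_map _ (Function.Embedding.subtype p) fun k => |J k i| * v k).symm.trans_le ?_
    refine Finset.sum_le_sum_of_subset_of_nonneg ?_ fun k _ _ =>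
      mul_nonneg (abs_nonneg _) (D.pos k).le
    intro k hk
    obtain ⟨l, hl, rfl⟩ := Finset.mem_map.1 hk
    simpa using hl

/-! ### The feedback system and the conclusion. -/

namespace ApproxFMP

variable {V : Type*} [Fintype V] [DecidableEq V] (M : GaussianGraphicalModel V) (F : Finset V)

/-- If the feedback gains are exact, the feedback system is a Schur complement of `J`, hence
nonsingular. -/
theorem isUnit_det_feedbackJ (m : FMPMessages F)
    (hg : ∀ p, (treeJ M F).mulVec (feedbackGain M F m p) = gainPotential M F p) :
    IsUnit (feedbackJ M F m).det := by
  classical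
  rw [isUnit_iff_ne_zero]
  intro h0
  obtain ⟨y, hy, hy0⟩ := Matrix.exists_mulVec_eq_zero_iff.2 h0
  -- Block elimination: this extends a kernel vector `y` of the feedback matrix to a kernel vector
  -- of `J`.
  let x : {i // i ∉ F} → ℝ := fun j => -∑ q, y q * feedbackGain M F m q j
  let z : V → ℝ := fun i => if hi : i ∈ F then y ⟨i, hi⟩ else x ⟨i, hi⟩
  have hsplit : ∀ i, M.J.mulVec z i =
      ∑ p : {p // p ∈ F}, M.J i p * y p + ∑ j : {j // j ∉ F}, M.J i j * x j := by
    intro i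
    rw [Matrix.mulVec, dotProduct, ← Fintype.sum_subtype_add_sum_subtype (fun k => k ∈ F)]
    congr 1
    · refine Finset.sum_congr (by ext; simp) fun p _ => ?_
      simp only [z, dif_pos p.2]
    · refine Finset.sum_congr (by ext; simp) fun p _ => ?_
      simp only [z, dif_neg p.2]
  have hswap : ∀ i : V, ∑ j : {j // j ∉ F}, M.J i j * x j =
      -∑ q, y q * ∑ j : {j // j ∉ F}, M.J i j * feedbackGain M F m q j := by
    intro i
    simp only [x, mul_neg, Finset.sum_neg_distrib, Finset.mul_sum]
    rw [Finset.sum_comm]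
    simp only [mul_left_comm]
  have hz : M.J.mulVec z = 0 := by
    funext i
    rw [hsplit, hswap, Pi.zero_apply]
    by_cases hi : i ∈ F
    · have h1 := congrFun hy0 ⟨i, hi⟩
      rw [Matrix.mulVec, dotProduct, Pi.zero_apply] at h1
      rw [← h1, ← sub_eq_add_neg, ← Finset.sum_sub_distrib]
      refine Finset.sum_congr rfl fun q _ => ?_
      have h2 : ∑ j : {j // j ∉ F}, M.J i j * feedbackGain M F m q j =
          ∑ j ∈ Finset.univ.filter (fun j : {j // j ∉ F} => M.graph.Adj i j),
            M.J i j * feedbackGain M F m q j := by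
        symm
        refine Finset.sum_subset (Finset.subset_univ _) fun j _ hj => ?_
        have hne : i ≠ j := fun h => j.2 (h ▸ hi)
        have : ¬ M.graph.Adj i j := by simpa using hj
        rw [M.adj_iff i j hne, not_not] at this
        rw [this, zero_mul]
      rw [h2, feedbackJ, Matrix.of_apply]
      ring
    · have h1 : ∀ q, ∑ j : {j // j ∉ F}, M.J i j * feedbackGain M F m q j = M.J i q :=
        fun q => congrFun (hg q) ⟨i, hi⟩
      simp only [h1, mul_comm (y _)]
      exact add_neg_cancel _
  have hz0 : z = 0 := by
    by_contra hne
    exact (Matrix.isUnit_iff_isUnit_det _).1 M.posDef.isUnit |>.ne_zero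
      (Matrix.exists_mulVec_eq_zero_iff.1 ⟨z, hne, hz⟩)
  refine hy (funext fun p => ?_)
  simpa [z, p.2] using congrFun hz0 p

end ApproxFMP

theorem proposition1 {V : Type*} [Fintype V] [DecidableEq V]
    (M : GaussianGraphicalModel V) (hnorm : ∀ i, M.J i i = 1) (hWS : M.WalkSummable)
    (F : Finset V) (hF : IsPseudoFVS M.graph F)
    (m₀ : FMPMessages F) (hm₀ : m₀.NonnegPrecision) :
    ApproxFMP.Converges M F m₀ := by
  obtain ⟨v, D⟩ := hWS.exists_scaledDominant hnorm
  have DT : LBP.ScaledDominant (ApproxFMP.treeGraph M F) (ApproxFMP.treeJ M F) (fun i => v i) :=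
    D.comap_subtype (fun i => i ∉ F)
  obtain ⟨base, hbase⟩ := DT.exists_convergesTo (ApproxFMP.treeh M F) m₀.base hm₀.1
  choose gain hgain using fun p =>
    DT.exists_convergesTo (ApproxFMP.gainPotential M F p) (m₀.gain p) (hm₀.2.1 p)
  obtain ⟨second, hsecond⟩ := DT.exists_convergesTo
    (ApproxFMP.revisedh M F ⟨base, gain, base⟩) m₀.second hm₀.2.2
  refine ⟨_, _, ⟨base, gain, second⟩, hbase, hgain, ?_, hsecond, rfl, rfl⟩
  refine ApproxFMP.isUnit_det_feedbackJ M F _ fun p => (hgain p).mulVec_mean DT.symm ?_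
  intro i j hij hadj
  by_contra hne
  exact hadj ((M.adj_iff i j fun h => hij (Subtype.ext h)).2 hne)
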